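/- Let $\mathbb{F}$ be an arbitrary field, let $V$ be an infinite-dimensional vector space over $\mathbb{F}$, and let $u$ be an endomorphism of $V$ of finite rank (i.e. its image $\operatorname{im} u$ is finite-dimensional) with trace zero, where the trace of a finite-rank endomorphism $u$ is the trace of the endomorphism of $\operatorname{im} u$ induced by $u$. Then there exist endomorphisms $a, b, c$ of $V$ such that $a^2 = b^2 = c^2 = 0$ and $u = a + b + c$. -/

import Mathlib

/-- The trace of a finite-rank endomorphism `u` of a vector space `V` (possibly
infinite-dimensional): the trace of the endomorphism of the finite-dimensional space `range u`
induced by `u`. It is meant for `u` of finite rank only. -/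
noncomputable def finiteRankTrace {F V : Type*} [Field F] [AddCommGroup V] [Module F V]
    (u : Module.End F V) : F :=
  LinearMap.trace F (LinearMap.range u)
    (u.restrict (p := LinearMap.range u) (q := LinearMap.range u)
      (fun x _ => LinearMap.mem_range_self u x))

/-! Let `R` be the range of `u` and `A` the induced endomorphism of `R`. Since `V` is
infinite-dimensional, `u` has a section over `R` whose image misses `R`, so up to a zero summand `u`
becomes `blockCompanion 0 A` on `R × R`. Changing the corner `0` to `Q` costs one square-zero map,
so it is enough to find `Q` with `blockCompanion Q A` a sum of two. If `A` is not scalar, trace zero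
gives `A = B + C` with `B`, `C` nilpotent; `Q = -(B * C)` makes the block matrix nilpotent, and a
nilpotent map is a sum of two square-zero maps. If `A` is scalar, it is a commutator, and an
explicit `Q` works. -/

/-! ### Sums of square-zero maps and block companion matrices -/

section SquareZero

variable {F V W G : Type*} [Field F] [AddCommGroup V] [Module F V] [AddCommGroup W] [Module F W]
  [AddCommGroup G] [Module F G]

/-- `u` is a sum of two endomorphisms with square zero. -/
def IsSumTwoSqZero (u : Module.End F V) : Prop :=
  ∃ a b : Module.End F V, a ^ 2 = 0 ∧ b ^ 2 = 0 ∧ u = a + b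

/-- `u` is a sum of three endomorphisms with square zero. -/
def IsSumThreeSqZero (u : Module.End F V) : Prop :=
  ∃ a b c : Module.End F V, a ^ 2 = 0 ∧ b ^ 2 = 0 ∧ c ^ 2 = 0 ∧ u = a + b + c

theorem IsSumThreeSqZero.of_equiv_prod {u : Module.End F V} {v : Module.End F W}
    (h : IsSumThreeSqZero v) (e : (W × G) ≃ₗ[F] V)
    (he : ∀ w k, u (e (w, k)) = e (v w, 0)) : IsSumThreeSqZero u := by
  obtain ⟨a, b, c, ha, hb, hc, rfl⟩ := h
  have key : ∀ a : Module.End F W, a ^ 2 = 0 →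
      (e.conj (a.prodMap (0 : Module.End F G))) ^ 2 = 0 := by
    intro a ha
    ext x
    have : a (a (e.symm x).1) = 0 := by
      have := LinearMap.congr_fun ha (e.symm x).1
      simpa [pow_two] using this
    simp [pow_two, LinearEquiv.conj_apply, this]
  refine ⟨_, _, _, key a ha, key b hb, key c hc, ?_⟩
  ext x
  obtain ⟨⟨w, k⟩, rfl⟩ := e.surjective x
  rw [he]
  simp [LinearEquiv.conj_apply, ← map_add]

/-- The endomorphism of `G × G` with block matrix `[[0, Q], [1, A]]`. -/
def blockCompanion (Q A : Module.End F G) : Module.End F (G × G) :=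
  (Q ∘ₗ LinearMap.snd F G G).prod (LinearMap.fst F G G + A ∘ₗ LinearMap.snd F G G)

@[simp] theorem blockCompanion_apply (Q A : Module.End F G) (x : G × G) :
    blockCompanion Q A x = (Q x.2, x.1 + A x.2) := rfl

theorem isSumThreeSqZero_blockCompanion_zero {A : Module.End F G} (Q : Module.End F G)
    (h : IsSumTwoSqZero (blockCompanion Q A)) : IsSumThreeSqZero (blockCompanion 0 A) := by
  obtain ⟨a, b, ha, hb, hab⟩ := h
  refine ⟨a, b, -(LinearMap.inl F G G ∘ₗ Q ∘ₗ LinearMap.snd F G G), ha, hb, ?_, ?_⟩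
  · ext x <;> simp [pow_two]
  · rw [← hab]
    ext x <;> simp

theorem isSumTwoSqZero_blockCompanion_of_commutator {A S K : Module.End F G}
    (h : ∀ x, K (S x) = S (K x) + A x) :
    IsSumTwoSqZero (blockCompanion (S + S * K * K * S) A) := by
  let χ : (G × G) →ₗ[F] G := LinearMap.fst F G G - (S * K) ∘ₗ LinearMap.snd F G G
  let γ : (G × G) →ₗ[F] G := LinearMap.snd F G G - K ∘ₗ χ
  let ψ₁ : G →ₗ[F] (G × G) := (1 + S * K * K : Module.End F G).prod K
  let ψ₂ : G →ₗ[F] (G × G) := (S * K : Module.End F G).prod 1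
  have hχ : ∀ a b, χ (a, b) = a - S (K b) := fun a b => rfl
  have hγ : ∀ a b, γ (a, b) = b - K (a - S (K b)) := fun a b => rfl
  have hψ₁ : ∀ c, ψ₁ c = (c + S (K (K c)), K c) := fun c => rfl
  have hψ₂ : ∀ c, ψ₂ c = (S (K c), c) := fun c => rfl
  -- Both squares vanish because `γ ∘ ψ₁ = 0` and `χ ∘ ψ₂ = 0`.
  refine ⟨ψ₁ ∘ₗ S ∘ₗ γ, ψ₂ ∘ₗ (1 + K * S * K : Module.End F G) ∘ₗ χ, ?_, ?_, ?_⟩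
  · refine LinearMap.ext fun x => ?_
    simp [pow_two, hψ₁, hγ]
  · refine LinearMap.ext fun x => ?_
    simp [pow_two, hψ₂, hχ]
  · refine LinearMap.ext fun x => ?_
    obtain ⟨a, b⟩ := x
    have hA : ∀ x, A x = K (S x) - S (K x) := fun x => by rw [h]; abel
    simp only [blockCompanion_apply, LinearMap.add_apply, LinearMap.comp_apply, hγ, hχ, hψ₁, hψ₂,
      Module.End.mul_apply, Module.End.one_apply, map_add, map_sub, hA, Prod.mk_add_mk]
    refine Prod.ext ?_ ?_ <;> simp only <;> abel

/-- The map `(a, b) ↦ a + B b` intertwines the block matrix with `B`; on its kernel, the graph of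
vectors `(-B b, b)`, the matrix acts as `C`. -/
theorem isNilpotent_blockCompanion {B C : Module.End F G} (hB : IsNilpotent B)
    (hC : IsNilpotent C) : IsNilpotent (blockCompanion (-(B * C)) (B + C)) := by
  obtain ⟨k, hk⟩ := hB
  obtain ⟨l, hl⟩ := hC
  set M := blockCompanion (-(B * C)) (B + C)
  have h1 : ∀ i x, ((M ^ i) x).1 + B ((M ^ i) x).2 = (B ^ i) (x.1 + B x.2) := by
    intro i x
    induction i with
    | zero => simp
    | succ i ih =>
      rw [pow_succ', pow_succ', Module.End.mul_apply, Module.End.mul_apply, ← ih]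
      simp only [M, blockCompanion_apply, LinearMap.neg_apply, Module.End.mul_apply,
        LinearMap.add_apply, map_add]
      abel
  have h2 : ∀ i b, (M ^ i) (-B b, b) = (-B ((C ^ i) b), (C ^ i) b) := by
    intro i b
    induction i with
    | zero => simp
    | succ i ih =>
      rw [pow_succ', pow_succ', Module.End.mul_apply, Module.End.mul_apply, ih]
      simp [M]
  refine ⟨l + k, LinearMap.ext fun x => ?_⟩
  have h3 : (M ^ k) x = (-B ((M ^ k) x).2, ((M ^ k) x).2) := by
    have := h1 k x
    rw [hk, LinearMap.zero_apply] at this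
    exact Prod.ext (eq_neg_of_add_eq_zero_left this) rfl
  rw [pow_add, Module.End.mul_apply, h3, h2, hl]
  simp

/-! ### Nilpotent maps are odd for some two-part grading -/

theorem Submodule.exists_le_disjoint_sup_eq {A B Z : Submodule F V} (hA : A ≤ Z) (hB : B ≤ Z)
    (h : Disjoint A B) : ∃ C, A ≤ C ∧ Disjoint C B ∧ C ⊔ B = Z := by
  obtain ⟨D, hD⟩ := exists_isCompl (A ⊔ B)
  have h1 : Disjoint (A ⊔ B) (D ⊓ Z) := hD.disjoint.mono_right inf_le_left
  refine ⟨A ⊔ D ⊓ Z, le_sup_left, ?_, ?_⟩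
  · have := h.symm.disjoint_sup_right_of_disjoint_sup_left (by rwa [sup_comm] at h1)
    exact this.symm
  · rw [sup_right_comm, ← sup_inf_assoc_of_le D (sup_le hA hB), hD.sup_eq_top, top_inf_eq]

/-- The preimages in `W` of `O'` and `E'` span `W` and meet in the kernel `K`. Removing `K1` from
one and `K0` from the other, where `K = K1 ⊕ K0`, makes them independent. -/
theorem exists_odd_grading_of_map {N : Module.End F V} {W E' O' : Submodule F V}
    (hW : W.map N ≤ W) (hd : Disjoint E' O') (hs : E' ⊔ O' = W.map N)
    (hE : E'.map N ≤ O') (hO : O'.map N ≤ E') :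
    ∃ E O : Submodule F V, Disjoint E O ∧ E ⊔ O = W ∧ E.map N ≤ O ∧ O.map N ≤ E := by
  set K := LinearMap.ker N ⊓ W
  set K0 := E' ⊓ K
  have hE'W : E' ≤ W := le_sup_left.trans (hs.le.trans hW)
  have hO'W : O' ≤ W := le_sup_right.trans (hs.le.trans hW)
  obtain ⟨K1, -, hK1d, hK1⟩ :=
    Submodule.exists_le_disjoint_sup_eq (Z := K) bot_le (inf_le_right : K0 ≤ K) disjoint_bot_left
  have hK1K : K1 ≤ K := hK1 ▸ le_sup_left
  have hKc : ∀ P : Submodule F V, K ≤ W ⊓ P.comap N := by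
    rintro P x ⟨hx, hxW⟩
    refine ⟨hxW, ?_⟩
    change N x ∈ P
    rw [show N x = 0 from hx]
    exact P.zero_mem
  obtain ⟨E, hE'E, hEd, hEs⟩ := Submodule.exists_le_disjoint_sup_eq (A := E') (B := K1)
    (Z := W ⊓ O'.comap N) (le_inf hE'W (Submodule.map_le_iff_le_comap.1 hE))
    (hK1K.trans (hKc _)) (by
      rw [Submodule.disjoint_def]
      intro x hx hx1
      exact Submodule.disjoint_def.1 hK1d x hx1 ⟨hx, hK1K hx1⟩)
  obtain ⟨O, hO'O, hOd, hOs⟩ := Submodule.exists_le_disjoint_sup_eq (A := O') (B := K0)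
    (Z := W ⊓ E'.comap N) (le_inf hO'W (Submodule.map_le_iff_le_comap.1 hO))
    ((inf_le_right : K0 ≤ K).trans (hKc _)) (hd.symm.mono_right inf_le_left)
  have hEZ : E ≤ W ⊓ O'.comap N := hEs ▸ le_sup_left
  have hOZ : O ≤ W ⊓ E'.comap N := hOs ▸ le_sup_left
  have hK0E : K0 ≤ E := inf_le_left.trans hE'E
  have hK1EO : K1 ≤ E ⊔ O :=
    hK1K.trans ((hKc E').trans (hOs.symm.le.trans (sup_le le_sup_right (hK0E.trans le_sup_left))))
  have hZ0 : W ⊓ O'.comap N ≤ E ⊔ O := hEs.symm.le.trans (sup_le le_sup_left hK1EO)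
  have hZ1 : W ⊓ E'.comap N ≤ E ⊔ O :=
    hOs.symm.le.trans (sup_le le_sup_right (hK0E.trans le_sup_left))
  refine ⟨E, O, ?_, le_antisymm (sup_le (hEZ.trans inf_le_left) (hOZ.trans inf_le_left)) ?_, ?_, ?_⟩
  · rw [Submodule.disjoint_def]
    intro x hxE hxO
    have hNx : N x = 0 := Submodule.disjoint_def.1 hd _ (hOZ hxO).2 (hEZ hxE).2
    have hxK : x ∈ K1 ⊔ K0 := hK1 ▸ ⟨hNx, (hEZ hxE).1⟩
    obtain ⟨k1, hk1, k0, hk0, rfl⟩ := Submodule.mem_sup.1 hxK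
    have : k1 = 0 := Submodule.disjoint_def.1 hEd k1
      ((Submodule.add_mem_iff_left _ (hK0E hk0)).1 hxE) hk1
    subst this
    rw [zero_add] at hxO ⊢
    exact Submodule.disjoint_def.1 hOd _ hxO hk0
  · intro x hx
    have hNx : N x ∈ E' ⊔ O' := hs ▸ Submodule.mem_map_of_mem hx
    obtain ⟨e, he, o, ho, heo⟩ := Submodule.mem_sup.1 hNx
    obtain ⟨y, hy, rfl⟩ : e ∈ W.map N := hs ▸ (le_sup_left : E' ≤ E' ⊔ O') he
    obtain ⟨z, hz, rfl⟩ : o ∈ W.map N := hs ▸ (le_sup_right : O' ≤ E' ⊔ O') ho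
    have hK : x - y - z ∈ K := by
      refine ⟨?_, W.sub_mem (W.sub_mem hx hy) hz⟩
      change N (x - y - z) = 0
      rw [map_sub, map_sub, ← heo]
      abel
    have h1 : y ∈ E ⊔ O := hZ1 ⟨hy, he⟩
    have h2 : z ∈ E ⊔ O := hZ0 ⟨hz, ho⟩
    have h3 := hZ0 (hKc O' hK)
    have := add_mem (add_mem h3 h2) h1
    convert this using 1
    abel
  · exact Submodule.map_le_iff_le_comap.2 ((hEZ.trans inf_le_right).trans
      (Submodule.comap_mono hO'O))
  · exact Submodule.map_le_iff_le_comap.2 ((hOZ.trans inf_le_right).trans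
      (Submodule.comap_mono hE'E))

theorem exists_odd_grading_of_isNilpotent {N : Module.End F V} (hN : IsNilpotent N) :
    ∃ E O : Submodule F V, IsCompl E O ∧ E.map N ≤ O ∧ O.map N ≤ E := by
  obtain ⟨k, hk⟩ := hN
  -- The grading is extended from `range (N ^ k) = ⊥` up to `range (N ^ 0) = ⊤`.
  have key : ∀ j ≤ k, ∃ E O : Submodule F V, Disjoint E O ∧
      E ⊔ O = LinearMap.range (N ^ (k - j)) ∧ E.map N ≤ O ∧ O.map N ≤ E := by
    intro j
    induction j with
    | zero => exact fun _ => ⟨⊥, ⊥, by simp [hk]⟩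
    | succ j ih =>
      intro hj
      obtain ⟨E, O, h1, h2, h3, h4⟩ := ih (by omega)
      have hr : (LinearMap.range (N ^ (k - (j + 1)))).map N = LinearMap.range (N ^ (k - j)) := by
        rw [← LinearMap.range_comp, ← Module.End.mul_eq_comp, ← pow_succ']
        congr 2
        omega
      refine exists_odd_grading_of_map ?_ h1 (h2.trans hr.symm) h3 h4
      rintro _ ⟨_, ⟨x, rfl⟩, rfl⟩
      refine ⟨N x, ?_⟩
      rw [← Module.End.mul_apply, ← Module.End.mul_apply, ← pow_succ, ← pow_succ']
  obtain ⟨E, O, h1, h2, h3, h4⟩ := key k le_rfl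
  refine ⟨E, O, ⟨h1, codisjoint_iff.2 ?_⟩, h3, h4⟩
  rw [h2]
  simp [Module.End.one_eq_id]

theorem IsNilpotent.isSumTwoSqZero {N : Module.End F V} (hN : IsNilpotent N) :
    IsSumTwoSqZero N := by
  obtain ⟨E, O, h, hE, hO⟩ := exists_odd_grading_of_isNilpotent hN
  have key : ∀ {E O : Submodule F V} (h : IsCompl E O), E.map N ≤ O →
      (N * E.projection O h) ^ 2 = 0 := by
    intro E O h hE
    ext x
    have : N (E.projection O h x) ∈ O := hE (Submodule.mem_map_of_mem (by simp))
    simp [pow_two, (Submodule.projection_apply_eq_zero_iff h).2 this]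
  refine ⟨N * E.projection O h, N * O.projection E h.symm, key h hE, key h.symm hO, ?_⟩
  rw [← mul_add, Submodule.projection_add_projection_eq_id h]
  rfl

end SquareZero

/-! ### Trace-zero matrices as sums of two nilpotents -/

section NilpotentSum

variable {F V : Type*} [Field F] [AddCommGroup V] [Module F V]

theorem LinearIndependent.exists_dual_apply_eq {ι : Type*} {w : ι → V}
    (hw : LinearIndependent F w) (c : ι → F) : ∃ f : V →ₗ[F] F, ∀ i, f (w i) = c i := by
  obtain ⟨g, hg⟩ := LinearMap.exists_leftInverse_of_injective (Finsupp.linearCombination F w)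
    (LinearMap.ker_eq_bot.2 hw)
  refine ⟨Finsupp.linearCombination F c ∘ₗ g, fun i => ?_⟩
  have := LinearMap.congr_fun hg (Finsupp.single i 1)
  simp only [LinearMap.comp_apply, Finsupp.linearCombination_single, one_smul,
    LinearMap.id_apply] at this
  simp [this]

/-- The projection onto the kernel of a linear form `f` along a vector `v` with `f v = 1`. -/
def kerProj (f : V →ₗ[F] F) (v : V) (hv : f v = 1) : V →ₗ[F] LinearMap.ker f :=
  (LinearMap.id - f.smulRight v).codRestrict (LinearMap.ker f) (fun x => by simp [hv])

theorem coe_kerProj {f : V →ₗ[F] F} {v : V} (hv : f v = 1) (x : V) :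
    (kerProj f v hv x : V) = x - f x • v := rfl

theorem kerProj_self {f : V →ₗ[F] F} {v : V} (hv : f v = 1) : kerProj f v hv v = 0 :=
  Subtype.ext (by simp [coe_kerProj, hv])

theorem kerProj_coe {f : V →ₗ[F] F} {v : V} (hv : f v = 1) (x : LinearMap.ker f) :
    kerProj f v hv x = x :=
  Subtype.ext (by simp [coe_kerProj])

/-- The compression of `A` to the kernel of `f` along `v`. -/
def kerCompress (A : Module.End F V) (f : V →ₗ[F] F) (v : V) (hv : f v = 1) :
    Module.End F (LinearMap.ker f) :=
  kerProj f v hv ∘ₗ A ∘ₗ (LinearMap.ker f).subtype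

theorem coe_kerCompress {A : Module.End F V} {f : V →ₗ[F] F} {v : V} (hv : f v = 1)
    (x : LinearMap.ker f) : (kerCompress A f v hv x : V) = A x - f (A x) • v := rfl

theorem trace_kerCompress [FiniteDimensional F V] {A : Module.End F V} {f : V →ₗ[F] F} {v : V}
    (hv : f v = 1) (hA : f (A v) = 0) :
    LinearMap.trace F _ (kerCompress A f v hv) = LinearMap.trace F _ A := by
  have h : A = (A ∘ₗ (LinearMap.ker f).subtype) ∘ₗ kerProj f v hv + f.smulRight (A v) := by
    ext x
    simp [coe_kerProj]
  conv_rhs => rw [h]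
  rw [map_add, LinearMap.trace_smulRight, hA, add_zero, kerCompress, LinearMap.trace_comp_comm']

/-- Along `ker f ⊕ F v` the diagonal entry of `A` at `v` is zero. `B` absorbs the remaining row and
`C` the remaining column; both stay block triangular with a zero corner, hence nilpotent. -/
theorem exists_isNilpotent_add_of_kerCompress {A : Module.End F V} {f : V →ₗ[F] F} {v : V}
    (hv : f v = 1) (hA : f (A v) = 0)
    (h : ∃ B C, IsNilpotent B ∧ IsNilpotent C ∧ kerCompress A f v hv = B + C) :
    ∃ B C : Module.End F V, IsNilpotent B ∧ IsNilpotent C ∧ A = B + C := by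
  obtain ⟨B, C, ⟨k, hk⟩, ⟨l, hl⟩, hBC⟩ := h
  let ι := (LinearMap.ker f).subtype
  let π := kerProj f v hv
  have hπι : ∀ x, π (ι x) = x := kerProj_coe hv
  have hπv : π v = 0 := kerProj_self hv
  have hfι : ∀ x, f (ι x) = 0 := fun x => x.2
  let B' : LinearMap.ker f →ₗ[F] V := ι ∘ₗ B + (f ∘ₗ A ∘ₗ ι).smulRight v
  let C' : V →ₗ[F] LinearMap.ker f := C ∘ₗ π + f.smulRight ⟨A v, hA⟩
  have hπB : ∀ i x, π (((B' ∘ₗ π : Module.End F V) ^ i) x) = (B ^ i) (π x) := by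
    intro i x
    induction i with
    | zero => simp
    | succ i ih =>
      rw [pow_succ', pow_succ', Module.End.mul_apply, Module.End.mul_apply, ← ih]
      simp [B', hπι, hπv]
  have hCι : ∀ i x, ((ι ∘ₗ C' : Module.End F V) ^ i) (ι x) = ι ((C ^ i) x) := by
    intro i x
    induction i with
    | zero => simp
    | succ i ih =>
      rw [pow_succ', pow_succ', Module.End.mul_apply, Module.End.mul_apply, ih]
      simp [C', hπι, hfι]
  refine ⟨B' ∘ₗ π, ι ∘ₗ C', ⟨k + 1, LinearMap.ext fun x => ?_⟩, ⟨l + 1, LinearMap.ext fun x => ?_⟩,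
    LinearMap.ext fun x => ?_⟩
  · rw [pow_succ', Module.End.mul_apply, LinearMap.comp_apply, hπB, hk]
    simp
  · rw [pow_succ, Module.End.mul_apply, LinearMap.comp_apply, hCι, hl]
    simp
  · have h1 : (kerCompress A f v hv (π x) : V) = ι (B (π x)) + ι (C (π x)) := by
      rw [hBC]; rfl
    rw [coe_kerCompress] at h1
    have h2 : A x = A (π x) + f x • A v := by
      simp [π, coe_kerProj]
    have h3 : (B' ∘ₗ π + ι ∘ₗ C') x
        = ι (B (π x)) + f (A (π x)) • v + (ι (C (π x)) + f x • A v) := rfl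
    rw [h3, h2, add_right_comm, ← add_assoc, ← h1]
    abel

theorem exists_kerCompress_ne_smul [FiniteDimensional F V] {A : Module.End F V}
    (hA : ∀ r : F, A ≠ r • 1) :
    ∃ (f : V →ₗ[F] F) (v : V) (hv : f v = 1), f (A v) = 0 ∧
      ((∀ r : F, kerCompress A f v hv ≠ r • 1) ∨ Module.finrank F V ≤ 2) := by
  obtain ⟨v, hv⟩ : ∃ v, LinearIndependent F ![v, A v] := by
    by_contra! hcon
    obtain ⟨r, hr⟩ := A.exists_eq_smul_id_of_forall_notLinearIndependent hcon
    exact hA r hr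
  obtain ⟨f, hf⟩ := hv.exists_dual_apply_eq ![1, 0]
  have hf0 : f v = 1 := hf 0
  have hf1 : f (A v) = 0 := hf 1
  by_cases hspan : Submodule.span F (Set.range ![v, A v]) = ⊤
  · refine ⟨f, v, hf0, hf1, Or.inr ?_⟩
    have := finrank_range_le_card (R := F) ![v, A v]
    rw [Set.finrank, hspan, finrank_top] at this
    simpa using this
  by_cases hs : ∀ r : F, kerCompress A f v hf0 ≠ r • 1
  · exact ⟨f, v, hf0, hf1, Or.inl hs⟩
  push Not at hs
  obtain ⟨r, hr⟩ := hs
  obtain ⟨y, hy⟩ : ∃ y, y ∉ Submodule.span F (Set.range ![v, A v]) := by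
    by_contra! hcon
    exact hspan (eq_top_iff.2 fun y _ => hcon y)
  have hvy : LinearIndependent F (Fin.cons y ![v, A v] : Fin 3 → V) :=
    linearIndependent_finCons.2 ⟨hv, hy⟩
  obtain ⟨g, hg⟩ := hvy.exists_dual_apply_eq ![0, 0, 1]
  obtain ⟨h, hh⟩ := hvy.exists_dual_apply_eq ![1, 0, 0]
  have hg0 : g y = 0 := hg 0
  have hg1 : g v = 0 := hg 1
  have hg2 : g (A v) = 1 := hg 2
  have hh0 : h y = 1 := hh 0
  have hh1 : h v = 0 := hh 1
  have hh2 : h (A v) = 0 := hh 2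
  -- If the compressions along `f` and `f + h` were both scalar, applying `g` to them at the
  -- projections of `y` would give `g (A y) = f y` and `g (A y) = f y + 1`.
  refine ⟨f + h, v, by simp [hf0, hh1], by simp [hf1, hh2], Or.inl fun s hs => ?_⟩
  have h1 := congrArg Subtype.val (LinearMap.congr_fun hr ⟨y - f y • v, by simp [hf0]⟩)
  have h2 := congrArg Subtype.val
    (LinearMap.congr_fun hs ⟨y - f y • v - v, by simp [hf0, hh0, hh1]⟩)
  rw [coe_kerCompress] at h1 h2
  replace h1 := congrArg g h1
  replace h2 := congrArg g h2
  simp [hg0, hg1, hg2] at h1 h2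
  simp [h1] at h2

theorem exists_isNilpotent_add [FiniteDimensional F V] {A : Module.End F V}
    (htr : LinearMap.trace F V A = 0) (hA : A = 0 ∨ ∀ r : F, A ≠ r • 1) :
    ∃ B C : Module.End F V, IsNilpotent B ∧ IsNilpotent C ∧ A = B + C := by
  induction hn : Module.finrank F V generalizing V with
  | zero =>
    have := Module.finrank_zero_iff.1 hn
    exact ⟨0, 0, .zero, .zero, LinearMap.ext fun x => Subsingleton.elim _ _⟩
  | succ n ih =>
    obtain rfl | hA := hA
    · exact ⟨0, 0, .zero, .zero, by simp⟩
    obtain ⟨f, v, hv, hfA, h⟩ := exists_kerCompress_ne_smul hA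
    have htr' := trace_kerCompress hv hfA
    rw [htr] at htr'
    have hker : Module.finrank F (LinearMap.ker f) = n := by
      have h1 := f.finrank_range_add_finrank_ker
      have h2 : LinearMap.range f = ⊤ := LinearMap.range_eq_top.2 fun c => ⟨c • v, by simp [hv]⟩
      rw [h2, finrank_top, Module.finrank_self] at h1
      omega
    refine exists_isNilpotent_add_of_kerCompress hv hfA (ih htr' ?_ hker)
    by_cases hs : ∀ r : F, kerCompress A f v hv ≠ r • 1
    · exact Or.inr hs
    obtain hs' | hle := h
    · exact absurd hs' hs
    -- Here the kernel has dimension at most 1, where a scalar of trace zero vanishes in any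
    -- characteristic.
    left
    push Not at hs
    obtain ⟨r, hr⟩ := hs
    rw [hr, map_smul, LinearMap.trace_one, hker, smul_eq_mul, mul_eq_zero] at htr'
    obtain rfl | h0 := htr'
    · rw [hr, zero_smul]
    · have : n = 0 ∨ n = 1 := by omega
      obtain rfl | rfl := this
      · have := Module.finrank_zero_iff.1 hker
        exact LinearMap.ext fun x => Subsingleton.elim _ _
      · simp at h0

end NilpotentSum

/-! ### Scalar blocks and reduction of finite-rank maps -/

section FiniteRank

variable {F V G : Type*} [Field F] [AddCommGroup V] [Module F V] [AddCommGroup G] [Module F G]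

/-- On `F[t]/(t ^ n)` take `S` to be multiplication by `t` and `K` to be `r • d/dt`, which preserves
the ideal because `r * n = 0`. -/
theorem exists_commutator_eq_smul [FiniteDimensional F G] {r : F}
    (h : r * Module.finrank F G = 0) :
    ∃ S K : Module.End F G, ∀ x, K (S x) = S (K x) + r • x := by
  obtain ⟨n, hn⟩ : ∃ n, n = Module.finrank F G := ⟨_, rfl⟩
  rw [← hn] at h
  let e : G ≃ₗ[F] (Fin n → F) := LinearEquiv.ofFinrankEq _ _ (by simp [hn])
  let S : Module.End F (Fin n → F) :=
    { toFun := fun f i => if i.1 = 0 then 0 else f ⟨i.1 - 1, by omega⟩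
      map_add' := fun f g => by ext i; by_cases hi : i.1 = 0 <;> simp [hi]
      map_smul' := fun c f => by ext i; by_cases hi : i.1 = 0 <;> simp [hi] }
  let K : Module.End F (Fin n → F) :=
    { toFun := fun f i => if hi : i.1 + 1 < n then r * (i.1 + 1 : ℕ) * f ⟨i.1 + 1, hi⟩ else 0
      map_add' := fun f g => by ext i; by_cases hi : i.1 + 1 < n <;> simp [hi, mul_add]
      map_smul' := fun c f => by
        ext i; by_cases hi : i.1 + 1 < n <;> simp [hi, mul_left_comm] }
  have hKS : ∀ f i, K (S f) i = r * (i.1 + 1 : ℕ) * f i := by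
    intro f i
    by_cases hi : i.1 + 1 < n
    · simp [K, S, hi]
    · have : i.1 + 1 = n := by omega
      rw [this, h, zero_mul]
      simp [K, hi]
  have hSK : ∀ f i, S (K f) i = r * (i.1 : ℕ) * f i := by
    intro f i
    obtain ⟨i, hi⟩ := i
    cases i with
    | zero => simp [S]
    | succ i => simp [S, K, hi]
  refine ⟨e.symm.conj S, e.symm.conj K, fun x => e.injective ?_⟩
  ext i
  simp [LinearEquiv.conj_apply, hKS, hSK]
  ring

theorem isSumThreeSqZero_blockCompanion_of_trace_eq_zero [FiniteDimensional F G]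
    {A : Module.End F G} (h : LinearMap.trace F G A = 0) :
    IsSumThreeSqZero (blockCompanion 0 A) := by
  by_cases hA : ∀ r : F, A ≠ r • 1
  · obtain ⟨B, C, hB, hC, rfl⟩ := exists_isNilpotent_add h (Or.inr hA)
    exact isSumThreeSqZero_blockCompanion_zero _
      (isNilpotent_blockCompanion hB hC).isSumTwoSqZero
  · push Not at hA
    obtain ⟨r, rfl⟩ := hA
    rw [map_smul, LinearMap.trace_one, smul_eq_mul] at h
    obtain ⟨S, K, hSK⟩ := exists_commutator_eq_smul h
    exact isSumThreeSqZero_blockCompanion_zero _ (isSumTwoSqZero_blockCompanion_of_commutator hSK)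

theorem exists_section_disjoint_range (hV : ¬ FiniteDimensional F V) (u : Module.End F V)
    [FiniteDimensional F (LinearMap.range u)] :
    ∃ σ : LinearMap.range u →ₗ[F] V, (∀ x, u (σ x) = x) ∧
      ∀ x, σ x ∈ LinearMap.range u → x = 0 := by
  obtain ⟨σ, hσ⟩ := u.rangeRestrict.exists_rightInverse_of_surjective u.range_rangeRestrict
  have hσ' : ∀ x, u (σ x) = x := fun x => congrArg Subtype.val (LinearMap.congr_fun hσ x)
  obtain ⟨D, hD⟩ := exists_isCompl (LinearMap.range u ⊔ LinearMap.range σ)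
  have hDinf : ¬ FiniteDimensional F D := by
    intro hfin
    refine hV (Module.finite_def.2 ?_)
    rw [← hD.sup_eq_top]
    exact (((Submodule.fg_iff_finiteDimensional _).2 inferInstance)).sup
      ((Submodule.fg_iff_finiteDimensional _).2 hfin)
  obtain ⟨δ, hδ⟩ : ∃ δ : LinearMap.range u →ₗ[F] D, Function.Injective δ := by
    refine Module.Free.exists_linearMap_injective_of_rank_lt
      ((Module.rank_lt_aleph0 F _).trans_le ?_)
    rwa [← not_lt, Module.rank_lt_aleph0_iff]
  let δ' : LinearMap.range u →ₗ[F] V := D.subtype ∘ₗ δ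
  -- Adding `δ'` pushes the section off `range u`; the correction `σ ∘ u ∘ δ'` keeps it a section.
  refine ⟨σ ∘ₗ (LinearMap.id - u.rangeRestrict ∘ₗ δ') + δ', fun x => ?_, fun x hx => ?_⟩
  · simp [hσ']
  · have h1 : δ' x ∈ LinearMap.range u ⊔ LinearMap.range σ := by
      have h2 := sub_mem ((le_sup_left : _ ≤ LinearMap.range u ⊔ LinearMap.range σ) hx)
        ((le_sup_right : _ ≤ LinearMap.range u ⊔ LinearMap.range σ)
          (LinearMap.mem_range_self σ (x - u.rangeRestrict (δ' x))))
      have h3 : (σ ∘ₗ (LinearMap.id - u.rangeRestrict ∘ₗ δ') + δ' : LinearMap.range u →ₗ[F] V) x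
          = σ (x - u.rangeRestrict (δ' x)) + δ' x := rfl
      rwa [h3, add_sub_cancel_left] at h2
    have h2 : δ' x = 0 := Submodule.disjoint_def.1 hD.disjoint _ h1 (δ x).2
    exact (map_eq_zero_iff δ hδ).1 (Subtype.ext h2)

theorem exists_equiv_prod_ker (u : Module.End F V) {σ : LinearMap.range u →ₗ[F] V}
    (hσ : ∀ x, u (σ x) = x) (hσr : ∀ x, σ x ∈ LinearMap.range u → x = 0) :
    ∃ (K : Submodule F V)
      (e : ((LinearMap.range u × LinearMap.range u) × K) ≃ₗ[F] V),
      K ≤ LinearMap.ker u ∧ ∀ a b k, e ((a, b), k) = σ a + b + k := by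
  set B := LinearMap.range u ⊔ LinearMap.range σ
  -- Complementing inside `ker u` makes `u` vanish on `K`; this still fills `V`, as `x - σ (u x)`
  -- lies in `ker u`.
  obtain ⟨K, -, hKd, hKs⟩ := Submodule.exists_le_disjoint_sup_eq (Z := LinearMap.ker u) bot_le
    (inf_le_right : B ⊓ LinearMap.ker u ≤ _) disjoint_bot_left
  have hK : K ≤ LinearMap.ker u := hKs ▸ le_sup_left
  let e : ((LinearMap.range u × LinearMap.range u) × K) →ₗ[F] V :=
    (σ.coprod (LinearMap.range u).subtype).coprod K.subtype
  have he : ∀ a b k, e ((a, b), k) = σ a + b + k := fun a b k => rfl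
  have hinj : Function.Injective e := by
    refine (injective_iff_map_eq_zero e).2 ?_
    rintro ⟨⟨a, b⟩, k⟩ h
    rw [he] at h
    have hσB : σ a + b ∈ B := add_mem ((le_sup_right : _ ≤ B) (LinearMap.mem_range_self σ a))
      ((le_sup_left : _ ≤ B) b.2)
    have hk : k = 0 := by
      refine Subtype.ext (Submodule.disjoint_def.1 hKd _ k.2 ⟨?_, hK k.2⟩)
      rw [eq_neg_of_add_eq_zero_right h]
      exact neg_mem hσB
    subst hk
    rw [Submodule.coe_zero, add_zero] at h
    have ha : a = 0 := by
      refine hσr a ?_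
      rw [eq_neg_of_add_eq_zero_left h]
      exact neg_mem b.2
    subst ha
    rw [map_zero, zero_add] at h
    have hb : b = 0 := Subtype.ext h
    rw [hb]
    rfl
  have hsurj : Function.Surjective e := by
    intro x
    have hx : x - σ (u.rangeRestrict x) ∈ K ⊔ B ⊓ LinearMap.ker u := by
      rw [hKs, LinearMap.mem_ker, map_sub, hσ]
      simp
    obtain ⟨k, hk, y, hy, hky⟩ := Submodule.mem_sup.1 hx
    obtain ⟨b, hb, _, ⟨a, rfl⟩, hba⟩ := Submodule.mem_sup.1 hy.1
    refine ⟨((a + u.rangeRestrict x, ⟨b, hb⟩), ⟨k, hk⟩), ?_⟩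
    calc e _ = k + (b + σ a) + σ (u.rangeRestrict x) := by
          rw [he, map_add]
          abel
      _ = x := by rw [hba, hky, sub_add_cancel]
  exact ⟨K, LinearEquiv.ofBijective e ⟨hinj, hsurj⟩, hK, he⟩

end FiniteRank

theorem mainTheorem6 {F V : Type*} [Field F] [AddCommGroup V] [Module F V]
    (hV : ¬ FiniteDimensional F V) (u : Module.End F V)
    (hu : LinearMap.HasFiniteRange u) (htr : finiteRankTrace u = 0) :
    ∃ a b c : Module.End F V, a ^ 2 = 0 ∧ b ^ 2 = 0 ∧ c ^ 2 = 0 ∧ u = a + b + c := by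
  have : FiniteDimensional F (LinearMap.range u) :=
    (Submodule.fg_iff_finiteDimensional _).1 hu.fg_range
  obtain ⟨σ, hσ, hσr⟩ := exists_section_disjoint_range hV u
  obtain ⟨K, e, hK, he⟩ := exists_equiv_prod_ker u hσ hσr
  refine (isSumThreeSqZero_blockCompanion_of_trace_eq_zero htr).of_equiv_prod e ?_
  rintro ⟨a, b⟩ k
  have hk : u k = 0 := hK k.2
  simp [he, hσ, hk]
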